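/- Let $k$ be a positive integer that is not a perfect square, let $d$ be a positive integer, and suppose that $\dfrac{4d^2}{k-d^2}\in\mathbb{Z}$. Let $f(x)=\dfrac{dx+k}{x+d}$, regarded as a transformation of the real projective line $\mathbb{R}\cup\{\infty\}$, and let $\{f^n(\infty)\}_{n\ge 1}=\{f(\infty),f(f(\infty)),\dots\}$ be the forward orbit of $\infty$. Call a continued fraction convergent $p/q$ of $\sqrt{k}$ (in lowest terms, with $p,q>0$) \emph{Pellian} if $p^2-kq^2=\pm1$. Let $F_0=0$, $F_1=1$, $F_{n+1}=F_n+F_{n-1}$ be the Fibonacci numbers and $G_0=0$, $G_1=1$, $G_{n+1}=2G_n+G_{n-1}$ the Pell numbers. Then the orbit $\{f^n(\infty)\}_{n\ge1}$ contains all Pellian convergents of $\sqrt{k}$ if and only if $(k,d)$ is not a pair of one of the following forms, with $s$ a positive integer: \begin{itemize} \item $k=5s^2$ and $d=3s$ or $d=5s$, where $2s\mid F_{2n+1}$ for some integer $n\ge0$; \item $k=2s^2$ and $d=2s$, where $s\mid G_{2n+1}$ for some integer $n\ge0$. \end{itemize} In every case (also for the exceptional pairs) the orbit contains all convergents $p/q$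 of $\sqrt{k}$ with $p^2-kq^2=1$. -/

import Mathlib

open scoped OnePoint

noncomputable section

/-- The linear fractional transformation `x ↦ (d x + k) / (x + d)` of the real projective line
`ℝ ∪ {∞}`, with `∞ ↦ d` and `-d ↦ ∞`. -/
def sqrtLFT (k d : ℝ) : OnePoint ℝ → OnePoint ℝ
  | ∞ => (d : OnePoint ℝ)
  | (x : ℝ) => if x + d = 0 then ∞ else (((d * x + k) / (x + d) : ℝ) : OnePoint ℝ)

/-- The forward orbit `{f(∞), f(f(∞)), …}` of `∞` under `f(x) = (d x + k) / (x + d)`. -/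
def orbitInfty (k d : ℝ) : Set (OnePoint ℝ) :=
  {y | ∃ n : ℕ, 1 ≤ n ∧ (sqrtLFT k d)^[n] ∞ = y}

/-- `p / q`, with `p, q > 0` in lowest terms, is a convergent of the simple continued fraction
of `√k`. -/
def IsSqrtConvergent (k p q : ℤ) : Prop :=
  0 < p ∧ 0 < q ∧ IsCoprime p q ∧
    ∃ n : ℕ, (GenContFract.of (Real.sqrt (k : ℝ))).convs n = (p : ℝ) / (q : ℝ)

/-- `p / q` is a Pellian convergent of `√k`. -/
def IsPellianConvergent (k p q : ℤ) : Prop :=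
  IsSqrtConvergent k p q ∧ (p ^ 2 - k * q ^ 2 = 1 ∨ p ^ 2 - k * q ^ 2 = -1)

/-- The Pell numbers `0, 1, 2, 5, 12, 29, …`. -/
def pellNumber : ℕ → ℕ
  | 0 => 0
  | 1 => 1
  | n + 2 => 2 * pellNumber (n + 1) + pellNumber n

/-- The exceptional pairs `(k, d)`. -/
def IsExceptionalPair (k d : ℤ) : Prop :=
  ∃ s : ℕ, 0 < s ∧
    ((k = 5 * (s : ℤ) ^ 2 ∧ (d = 3 * (s : ℤ) ∨ d = 5 * (s : ℤ)) ∧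
        ∃ n : ℕ, 2 * s ∣ Nat.fib (2 * n + 1)) ∨
      (k = 2 * (s : ℤ) ^ 2 ∧ d = 2 * (s : ℤ) ∧ ∃ n : ℕ, s ∣ pellNumber (2 * n + 1)))

end

/-! Put α = d + √k, with conjugate α' = d - √k. Diagonalising f at its fixed points ±√k gives f^n(∞)
= √k (αⁿ + α'ⁿ)/(αⁿ - α'ⁿ), so p/q is in the orbit as soon as ε = p + q√k satisfies ε α'ⁿ = ε' αⁿ
for some n ≥ 1.

Removing a common scale s, with k = s²k₁ and d = s d₁, makes the pair primitive. For a primitive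
pair let M = |k - d²|, let τ be the sign of d² - k, and let B = α/√M. The divisibility hypothesis
makes B² a unit of norm 1 in ℤ[√k] or ℤ[(1 + √k)/2] (`exists_orderData`). Dividing ε by powers of B²
leaves a unit w of the same norm σ in [1, B], up to inversion. Comparing w ± w⁻¹ with B ± B⁻¹ shows
that only w = 1 and w = B are possible (`OrderData.eq_of_le`), unless τ = 1 and σ = -1. Hence ε = Bⁿ
with σ = τⁿ, which is the orbit condition; this settles norm 1 completely.

In the remaining case d² > k and σ = -1, the small unit satisfies X² + 4 = kY² and MX² ≤ 4k, which
leaves only (2, 2), (5, 3) and (5, 5). There solvability of the negative Pell equation for the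
scaled k becomes the divisibility condition on Fibonacci or Pell numbers. Such pairs do fail: when
d² > k the whole orbit lies above √k, while solutions of norm -1 lie below it. -/

/-! ### The orbit in closed form. -/

theorem iterate_sqrtLFT_infty {k d : ℝ} (hk : 0 < k) (hd : 0 < d) (n : ℕ) (hn : 1 ≤ n) :
    (d - √k) ^ n < (d + √k) ^ n ∧ (sqrtLFT k d)^[n] ∞ =
      ((√k * ((d + √k) ^ n + (d - √k) ^ n) / ((d + √k) ^ n - (d - √k) ^ n) : ℝ) : OnePoint ℝ) := by
  have hr : 0 < √k := Real.sqrt_pos.2 hk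
  have hrr : √k * √k = k := Real.mul_self_sqrt hk.le
  have hlt : ∀ n : ℕ, 1 ≤ n → |(d - √k) ^ n| < (d + √k) ^ n := by
    intro n hn
    rw [abs_pow]
    exact pow_lt_pow_left₀ (abs_lt.2 ⟨by linarith, by linarith⟩) (abs_nonneg _) (by omega)
  refine ⟨(le_abs_self _).trans_lt (hlt n hn), ?_⟩
  induction n, hn using Nat.le_induction with
  | base =>
    simp only [Function.iterate_one, pow_one]
    change ((d : ℝ) : OnePoint ℝ) = _
    congr 1
    rw [eq_div_iff (by linarith)]
    ring
  | succ n hn ih =>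
    rw [Function.iterate_succ_apply', ih]
    have h1 := abs_lt.1 (hlt n hn)
    have h2 := abs_lt.1 (hlt (n + 1) (by omega))
    simp only [pow_succ] at h2 ⊢
    set a := (d + √k) ^ n
    set b := (d - √k) ^ n
    have hab : 0 < a - b := by linarith
    have hab' : 0 < a + b := by linarith
    have hpos : 0 < √k * (a + b) / (a - b) + d := by positivity
    have hD : 0 < a * (d + √k) - b * (d - √k) := by linarith
    change (if √k * (a + b) / (a - b) + d = 0 then ∞ else _) = _
    rw [if_neg hpos.ne']
    congr 1
    rw [div_eq_div_iff hpos.ne' hD.ne']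
    field_simp
    generalize √k = r at *
    subst hrr
    ring

theorem mem_orbitInfty_of_conj {k d p q : ℝ} (hk : 0 < k) (hd : 0 < d) (hq : q ≠ 0) {n : ℕ}
    (hn : 1 ≤ n) (h : (p + q * √k) * (d - √k) ^ n = (p - q * √k) * (d + √k) ^ n) :
    ((p / q : ℝ) : OnePoint ℝ) ∈ orbitInfty k d := by
  obtain ⟨h1, h2⟩ := iterate_sqrtLFT_infty hk hd n hn
  refine ⟨n, hn, h2.trans ?_⟩
  congr 1
  rw [div_eq_div_iff (by linarith) hq]
  linarith

theorem sqrt_lt_of_mem_orbitInfty {k d x : ℝ} (hk : 0 < k) (hd : 0 < d) (hkd : k < d ^ 2)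
    (hx : (x : OnePoint ℝ) ∈ orbitInfty k d) : √k < x := by
  obtain ⟨n, hn, h⟩ := hx
  obtain ⟨h1, h2⟩ := iterate_sqrtLFT_infty hk hd n hn
  have := OnePoint.coe_injective (h2.symm.trans h)
  have hr : √k < d := (Real.sqrt_lt' hd).2 hkd
  have hb : 0 < (d - √k) ^ n := pow_pos (by linarith) n
  have hr0 : 0 < √k := Real.sqrt_pos.2 hk
  rw [← this, lt_div_iff₀ (by linarith)]
  nlinarith

/-! ### Negative Pell equations: convergents, Fibonacci and Pell numbers. -/

/-- Legendre's criterion: √k - p/q = 1/(q(q√k + p)), and q√k + p > 2q because p ≥ q and √k > 1. -/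
theorem isSqrtConvergent_of_neg_pell {k p q : ℤ} (hk : 2 ≤ k) (hp : 0 < p) (hq : 0 < q)
    (h : p ^ 2 - k * q ^ 2 = -1) : IsSqrtConvergent k p q := by
  have hcop : IsCoprime p q := ⟨-p, k * q, by linear_combination -h⟩
  refine ⟨hp, hq, hcop, ?_⟩
  have hpq : q ≤ p := by
    by_contra! hlt
    nlinarith
  have hkR : (2 : ℝ) ≤ k := by exact_mod_cast hk
  have hqR : (0 : ℝ) < q := by exact_mod_cast hq
  have hpR : (q : ℝ) ≤ p := by exact_mod_cast hpq
  have hR : (p : ℝ) ^ 2 - k * q ^ 2 = -1 := by exact_mod_cast h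
  have hr : 1 < √(k : ℝ) := Real.lt_sqrt_of_sq_lt (by linarith)
  have hrr : √(k : ℝ) ^ 2 = k := Real.sq_sqrt (by linarith)
  have hden : ((p / q : ℚ).den : ℤ) = q :=
    Rat.den_div_eq_of_coprime hq (Int.isCoprime_iff_nat_coprime.1 hcop)
  obtain ⟨n, hn⟩ := Real.exists_convs_eq_rat (ξ := √(k : ℝ)) (q := (p / q : ℚ)) (by
    have hden' : ((p / q : ℚ).den : ℝ) = q := by exact_mod_cast hden
    rw [hden']
    push_cast
    generalize √(k : ℝ) = r at *
    have e : (r - p / q) * (q * (q * r + p)) = 1 := by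
      field_simp
      rw [← hrr] at hR
      linarith
    have hs : 0 < q * (q * r + p) := by positivity
    rw [eq_div_of_mul_eq hs.ne' e, abs_of_pos (by positivity)]
    apply one_div_lt_one_div_of_lt (by positivity)
    nlinarith)
  exact ⟨n, by rw [hn]; push_cast; rfl⟩

/-- Descent: multiplying (x + y√5)/2 by the unit (3 - √5)/2 gives the smaller solution (u, v). The
formula for x + y is carried along so that the Fibonacci recurrence closes the induction. -/
theorem exists_fib_of_neg_pell_five (y : ℕ) : ∀ x : ℕ, x ^ 2 + 4 = 5 * y ^ 2 →
    ∃ n : ℕ, y = Nat.fib (2 * n + 1) ∧ x + y = 2 * Nat.fib (2 * n + 2) := by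
  induction y using Nat.strong_induction_on with
  | _ y ih =>
    intro x h
    rcases Nat.lt_or_ge x 2 with hx | hx
    · interval_cases x
      · omega
      · have : y = 1 := by nlinarith
        exact ⟨0, by simp [this]⟩
    · have h1 : x < 3 * y := by nlinarith
      have h2 : y < x := by nlinarith
      have h3 : 5 * y ≤ 3 * x := by nlinarith
      have hpar : x % 2 = y % 2 := by
        have := congrArg (· % 2) h
        rcases Nat.mod_two_eq_zero_or_one x with hx | hx <;>
          rcases Nat.mod_two_eq_zero_or_one y with hy | hy <;>
          simp [Nat.add_mod, Nat.mul_mod, Nat.pow_mod, hx, hy] at this ⊢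
      obtain ⟨u, hu⟩ : ∃ u, 3 * x = 5 * y + 2 * u := ⟨(3 * x - 5 * y) / 2, by omega⟩
      obtain ⟨v, hv⟩ : ∃ v, 3 * y = x + 2 * v := ⟨(3 * y - x) / 2, by omega⟩
      obtain ⟨n, hn1, hn2⟩ := ih v (by omega) u (by zify at *; nlinarith)
      have e1 : Nat.fib (2 * (n + 1) + 1) = Nat.fib (2 * n + 1) + Nat.fib (2 * n + 2) :=
        Nat.fib_add_two (n := 2 * n + 1)
      have e2 : Nat.fib (2 * (n + 1) + 2) = Nat.fib (2 * n + 2) + Nat.fib (2 * (n + 1) + 1) :=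
        Nat.fib_add_two (n := 2 * n + 2)
      exact ⟨n + 1, by omega, by omega⟩

/-- The same descent, with the unit 3 - 2√2. -/
theorem exists_pellNumber_of_neg_pell_two (y : ℕ) : ∀ x : ℕ, x ^ 2 + 1 = 2 * y ^ 2 →
    ∃ n : ℕ, y = pellNumber (2 * n + 1) ∧ x + y = pellNumber (2 * n + 2) := by
  induction y using Nat.strong_induction_on with
  | _ y ih =>
    intro x h
    rcases Nat.lt_or_ge x 2 with hx | hx
    · interval_cases x
      · omega
      · have : y = 1 := by nlinarith
        exact ⟨0, by simp [this, pellNumber]⟩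
    · have h1 : x < 2 * y := by nlinarith
      have h2 : y < x := by nlinarith
      have h4 : 2 * x ≤ 3 * y := by nlinarith
      have h3 : 4 * y ≤ 3 * x := by nlinarith
      obtain ⟨u, hu⟩ : ∃ u, 3 * x = 4 * y + u := ⟨3 * x - 4 * y, by omega⟩
      obtain ⟨v, hv⟩ : ∃ v, 3 * y = 2 * x + v := ⟨3 * y - 2 * x, by omega⟩
      obtain ⟨n, hn1, hn2⟩ := ih v (by omega) u (by zify at *; nlinarith)
      refine ⟨n + 1, ?_, ?_⟩
      · change y = 2 * pellNumber (2 * n + 2) + pellNumber (2 * n + 1)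
        omega
      · change x + y = 2 * (2 * pellNumber (2 * n + 2) + pellNumber (2 * n + 1)) +
          pellNumber (2 * n + 2)
        omega

theorem exists_sq_add_four_eq_fib (n : ℕ) : ∃ x : ℕ, 0 < x ∧
    x ^ 2 + 4 = 5 * Nat.fib (2 * n + 1) ^ 2 ∧
    x + Nat.fib (2 * n + 1) = 2 * Nat.fib (2 * n + 2) := by
  induction n with
  | zero => exact ⟨1, by simp⟩
  | succ n ih =>
    obtain ⟨x, hx, h1, h2⟩ := ih
    have e1 : Nat.fib (2 * (n + 1) + 1) = Nat.fib (2 * n + 1) + Nat.fib (2 * n + 2) :=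
      Nat.fib_add_two (n := 2 * n + 1)
    have e2 : Nat.fib (2 * (n + 1) + 2) = Nat.fib (2 * n + 2) + Nat.fib (2 * (n + 1) + 1) :=
      Nat.fib_add_two (n := 2 * n + 2)
    rw [e2, e1]
    generalize Nat.fib (2 * n + 1) = y at *
    generalize Nat.fib (2 * n + 2) = z at *
    exact ⟨3 * z + y, by omega, by
      obtain rfl : x = 2 * z - y := by omega
      zify [show y ≤ 2 * z by omega] at *
      linarith, by omega⟩

theorem exists_sq_add_one_eq_pellNumber (n : ℕ) : ∃ x : ℕ, 0 < x ∧
    x ^ 2 + 1 = 2 * pellNumber (2 * n + 1) ^ 2 ∧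
    x + pellNumber (2 * n + 1) = pellNumber (2 * n + 2) := by
  induction n with
  | zero => exact ⟨1, by simp [pellNumber]⟩
  | succ n ih =>
    obtain ⟨x, hx, h1, h2⟩ := ih
    have e1 : pellNumber (2 * (n + 1) + 1) =
      2 * pellNumber (2 * n + 2) + pellNumber (2 * n + 1) := rfl
    have e2 : pellNumber (2 * (n + 1) + 2) =
      2 * pellNumber (2 * (n + 1) + 1) + pellNumber (2 * n + 2) := rfl
    rw [e2, e1]
    generalize pellNumber (2 * n + 1) = y at *
    generalize pellNumber (2 * n + 2) = z at *
    exact ⟨3 * x + 4 * y, by omega, by zify at *; nlinarith, by omega⟩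

/-! ### Units of the quadratic order. -/

/-- `w` is an element `(X + Y√k)/2` of norm `σ` of the order `ℤ[√k]`, or, if `c` holds, of the
order `ℤ[(1 + √k)/2]`. -/
def IsOrderElement (k : ℤ) (c : Prop) (σ : ℤ) (w : ℝ) : Prop :=
  ∃ X Y : ℤ, Even (X - Y) ∧ (c ∨ Even Y) ∧ X ^ 2 - k * Y ^ 2 = 4 * σ ∧
    w = (X + Y * √(k : ℝ)) / 2

namespace IsOrderElement

variable {k σ τ : ℤ} {c : Prop} {w z : ℝ}

theorem mul (hk : 0 ≤ k) (hc : c → k % 4 = 1) (hw : IsOrderElement k c σ w)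
    (hz : IsOrderElement k c τ z) : IsOrderElement k c (σ * τ) (w * z) := by
  obtain ⟨X, Y, ⟨a, ha⟩, hY, hn, rfl⟩ := hw
  obtain ⟨U, V, ⟨b, hb⟩, hV, hm, rfl⟩ := hz
  have hrr : √(k : ℝ) ^ 2 = k := Real.sq_sqrt (by exact_mod_cast hk)
  obtain rfl : X = Y + 2 * a := by linarith
  obtain rfl : U = V + 2 * b := by linarith
  by_cases h : c
  · obtain ⟨j, rfl⟩ : ∃ j, k = 4 * j + 1 := ⟨k / 4, by have := hc h; omega⟩
    refine ⟨Y * V + a * V + b * Y + 2 * a * b + 2 * j * Y * V, Y * V + a * V + b * Y,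
      ⟨a * b + j * Y * V, by ring⟩, Or.inl h, ?_, ?_⟩
    · apply mul_left_cancel₀ (four_ne_zero (α := ℤ))
      linear_combination ((V + 2 * b) ^ 2 - (4 * j + 1) * V ^ 2) * hn + 4 * σ * hm
    · push_cast at hrr ⊢
      linear_combination (Y * V / 4 : ℝ) * hrr
  · obtain ⟨y, rfl⟩ := hY.resolve_left h
    obtain ⟨v, rfl⟩ := hV.resolve_left h
    refine ⟨2 * ((y + a) * (v + b) + k * y * v), 2 * ((y + a) * v + y * (v + b)),
      ⟨(y + a) * (v + b) + k * y * v - ((y + a) * v + y * (v + b)), by ring⟩,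
      Or.inr (even_two_mul _), ?_, ?_⟩
    · apply mul_left_cancel₀ (four_ne_zero (α := ℤ))
      linear_combination ((v + v + 2 * b) ^ 2 - k * (v + v) ^ 2) * hn + 4 * σ * hm
    · push_cast at hrr ⊢
      linear_combination (y * v : ℝ) * hrr

theorem one : IsOrderElement k c 1 1 :=
  ⟨2, 0, by decide, Or.inr (by decide), by ring, by simp⟩

theorem pow (hk : 0 ≤ k) (hc : c → k % 4 = 1) (hw : IsOrderElement k c 1 w) (n : ℕ) :
    IsOrderElement k c 1 (w ^ n) := by
  induction n with
  | zero => simpa using one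
  | succ n ih => simpa [pow_succ] using ih.mul hk hc hw

/-- Since w times its conjugate is σ, this gives X = w + σw⁻¹ and Y√k = w - σw⁻¹: bounds on w become
bounds on integers. -/
theorem conj_eq (hk : 0 ≤ k) {X Y : ℤ} (hn : X ^ 2 - k * Y ^ 2 = 4 * σ)
    (hw : w = (X + Y * √(k : ℝ)) / 2) (hw0 : w ≠ 0) :
    (X - Y * √(k : ℝ)) / 2 = σ * w⁻¹ := by
  have hrr : √(k : ℝ) ^ 2 = k := Real.sq_sqrt (by exact_mod_cast hk)
  have hn' : (X : ℝ) ^ 2 - k * Y ^ 2 = 4 * σ := by exact_mod_cast hn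
  rw [eq_mul_inv_iff_mul_eq₀ hw0, hw]
  linear_combination hn' / 4 - (Y ^ 2 / 4 : ℝ) * hrr

theorem inv (hk : 0 ≤ k) (hσ : σ = 1 ∨ σ = -1) (hw : IsOrderElement k c σ w) (hw0 : w ≠ 0) :
    IsOrderElement k c σ w⁻¹ := by
  obtain ⟨X, Y, ⟨a, ha⟩, hY, hn, h⟩ := hw
  have := conj_eq hk hn h hw0
  rcases hσ with rfl | rfl
  · refine ⟨X, -Y, ⟨a + Y, by linarith⟩, by simpa using hY, by linarith, ?_⟩
    push_cast at this ⊢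
    linarith
  · refine ⟨-X, Y, ⟨-a - Y, by linarith⟩, hY, by linarith, ?_⟩
    push_cast at this ⊢
    linarith

end IsOrderElement

theorem add_inv_lt_add_inv {w B : ℝ} (hw : 1 ≤ w) (h : w < B) : w + w⁻¹ < B + B⁻¹ := by
  have h1 : 0 < w := by linarith
  have h2 : 0 < B := by linarith
  have : (B + B⁻¹) - (w + w⁻¹) = (B - w) * (w * B - 1) / (w * B) := by
    field_simp
    ring
  have h3 : 0 < (B - w) * (w * B - 1) / (w * B) := by
    apply div_pos (mul_pos (by linarith) (by nlinarith)) (by positivity)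
  linarith

/-! ### Reduction of units modulo powers of B². -/

/-- The data attached to a primitive pair `(k, d)`: the absolute value `M = |k - d²|` of the norm
of `d + √k`, and a type `c` of the order containing the unit `(d + √k)² / M`. -/
structure OrderData (k d M τ : ℤ) (c : Prop) : Prop where
  k_pos : 0 < k
  d_pos : 0 < d
  M_pos : 0 < M
  sign : τ = 1 ∨ τ = -1
  sq_sub : d ^ 2 - k = τ * M
  mod_four : c → k % 4 = 1
  four_le : c → 4 ≤ M
  unit : IsOrderElement k c 1 ((d + √(k : ℝ)) ^ 2 / M)

namespace OrderData

variable {k d M τ σ : ℤ} {c : Prop} {w B : ℝ}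

theorem four_le_mul_sq (h : OrderData k d M τ c) {Y : ℤ} (hY : c ∨ Even Y) (hY0 : Y ≠ 0) :
    4 ≤ M * Y ^ 2 := by
  have h0 := h.M_pos
  have hpos : 0 < Y ^ 2 := by positivity
  rcases hY with hc | ⟨y, rfl⟩
  · have := h.four_le hc
    nlinarith
  · have : 0 < y ^ 2 := by
      have : y ≠ 0 := by rintro rfl; simp at hY0
      positivity
    nlinarith

theorem one_lt (h : OrderData k d M τ c) (hB0 : 0 < B) (hB : B ^ 2 * M = (d + √(k : ℝ)) ^ 2) :
    1 < B := by
  have hk : (0 : ℝ) < k := by exact_mod_cast h.k_pos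
  have hd : (0 : ℝ) < d := by exact_mod_cast h.d_pos
  have hM : (0 : ℝ) < M := by exact_mod_cast h.M_pos
  have hrr : √(k : ℝ) ^ 2 = k := Real.sq_sqrt hk.le
  have hr : 0 < √(k : ℝ) := Real.sqrt_pos.2 hk
  have hs : (d : ℝ) ^ 2 - k = τ * M := by exact_mod_cast h.sq_sub
  have hlt : (M : ℝ) < (d + √(k : ℝ)) ^ 2 := by
    rcases h.sign with rfl | rfl <;> push_cast at hs <;> nlinarith
  by_contra! hle
  nlinarith [mul_le_mul hle hle hB0.le (by norm_num)]

/-- The conjugate α'/√M of B equals τB⁻¹, so the sum and difference are 2d/√M and 2√k/√M. -/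
theorem inv_mul_sq (h : OrderData k d M τ c) (hB0 : 0 < B)
    (hB : B ^ 2 * M = (d + √(k : ℝ)) ^ 2) :
    (B + τ * B⁻¹) ^ 2 * M = 4 * d ^ 2 ∧ (B - τ * B⁻¹) ^ 2 * M = 4 * k := by
  have hk : (0 : ℝ) < k := by exact_mod_cast h.k_pos
  have hd : (0 : ℝ) < d := by exact_mod_cast h.d_pos
  have hM : (0 : ℝ) < M := by exact_mod_cast h.M_pos
  have hrr : √(k : ℝ) ^ 2 = k := Real.sq_sqrt hk.le
  have hr : 0 < √(k : ℝ) := Real.sqrt_pos.2 hk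
  have hs : (d : ℝ) ^ 2 - k = τ * M := by exact_mod_cast h.sq_sub
  have hτ : (τ : ℝ) ^ 2 = 1 := by rcases h.sign with rfl | rfl <;> norm_num
  have hinv : (B⁻¹) ^ 2 * M = (d - √(k : ℝ)) ^ 2 := by
    have h1 : ((B⁻¹) ^ 2 * M) * (d + √(k : ℝ)) ^ 2 = M ^ 2 := by
      rw [← hB]
      field_simp
    have h2 : (d - √(k : ℝ)) ^ 2 * (d + √(k : ℝ)) ^ 2 = M ^ 2 := by
      rw [← mul_pow, show (d - √(k : ℝ)) * (d + √(k : ℝ)) = τ * M by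
        linear_combination hs - hrr, mul_pow, hτ, one_mul]
    have h3 : (d + √(k : ℝ)) ^ 2 ≠ 0 := by positivity
    exact mul_right_cancel₀ h3 (h1.trans h2.symm)
  have hBB : B * B⁻¹ = 1 := mul_inv_cancel₀ hB0.ne'
  constructor
  · linear_combination hB + hinv + 2 * τ * M * hBB + (B⁻¹) ^ 2 * M * hτ - 2 * hs + 2 * hrr
  · linear_combination hB + hinv - 2 * τ * M * hBB + (B⁻¹) ^ 2 * M * hτ + 2 * hs + 2 * hrr

/-- The size of w + w⁻¹ is compared with that of B + B⁻¹, using MY² ≥ 4. For σ = 1, w + w⁻¹ = X and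
MX² = kMY² + 4M ≥ 4k + 4M; this is 4d² if τ = 1, forcing w = B, and exceeds the available 4k if τ =
-1. For σ = τ = -1, w + w⁻¹ = Y√k and MkY² ≥ 4k again forces w = B. -/
theorem eq_of_le (h : OrderData k d M τ c) (hB0 : 0 < B)
    (hB : B ^ 2 * M = (d + √(k : ℝ)) ^ 2) (hσ : σ = 1 ∨ σ = -1) (hτσ : ¬ (τ = 1 ∧ σ = -1))
    (hw : IsOrderElement k c σ w) (hw1 : 1 < w) (hwB : w ≤ B) : w = B ∧ σ = τ := by
  obtain ⟨X, Y, -, hY, hn, hwe⟩ := hw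
  have hk : (0 : ℝ) < k := by exact_mod_cast h.k_pos
  have hM : (0 : ℝ) < M := by exact_mod_cast h.M_pos
  have hrr : √(k : ℝ) ^ 2 = k := Real.sq_sqrt hk.le
  have hconj := IsOrderElement.conj_eq h.k_pos.le hn hwe (by linarith)
  have hi : w⁻¹ < 1 := inv_lt_one_of_one_lt₀ hw1
  have hi0 : 0 < w⁻¹ := by positivity
  have hY0 : Y ≠ 0 := by
    rintro rfl
    rcases hσ with rfl | rfl <;> push_cast at hconj hwe <;> nlinarith
  have h4 := h.four_le_mul_sq hY hY0
  have h4R : (4 : ℝ) ≤ M * Y ^ 2 := by exact_mod_cast h4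
  obtain ⟨e1, e2⟩ := h.inv_mul_sq hB0 hB
  have hs : (d : ℝ) ^ 2 - k = τ * M := by exact_mod_cast h.sq_sub
  have hnR : (X : ℝ) ^ 2 - k * Y ^ 2 = 4 * σ := by exact_mod_cast hn
  have hBi : 0 < B⁻¹ := by positivity
  have hle : (w + w⁻¹) ^ 2 ≤ (B + B⁻¹) ^ 2 := by
    rcases hwB.eq_or_lt with rfl | hlt
    · exact le_rfl
    · exact pow_le_pow_left₀ (by positivity) (add_inv_lt_add_inv hw1.le hlt).le 2
  have hle' := mul_le_mul_of_nonneg_right hle hM.le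
  have hlt' : w < B → (w + w⁻¹) ^ 2 * M < (B + B⁻¹) ^ 2 * M := fun hlt ↦ by
    have := add_inv_lt_add_inv hw1.le hlt
    have := pow_lt_pow_left₀ this (by positivity) two_ne_zero
    exact mul_lt_mul_of_pos_right this hM
  have hkM := mul_le_mul_of_nonneg_left h4R hk.le
  rcases h.sign with rfl | rfl <;> rcases hσ with rfl | rfl <;>
    push_cast [one_mul] at e1 e2 hs hconj hnR
  · have hX : w + w⁻¹ = X := by linarith
    rw [hX, e1] at hlt'
    refine ⟨?_, rfl⟩
    by_contra hne
    have := hlt' (lt_of_le_of_ne hwB hne)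
    nlinarith
  · exact absurd ⟨rfl, rfl⟩ hτσ
  · have hX : w + w⁻¹ = X := by linarith
    rw [hX, show B + B⁻¹ = B - -1 * B⁻¹ by ring, e2] at hle'
    nlinarith
  · have hX : w + w⁻¹ = Y * √(k : ℝ) := by linarith
    rw [hX, show B + B⁻¹ = B - -1 * B⁻¹ by ring, e2, mul_pow, hrr] at hlt'
    refine ⟨?_, rfl⟩
    by_contra hne
    have := hlt' (lt_of_le_of_ne hwB hne)
    nlinarith

/-- Dividing by a power of `B²`, a unit is moved into `[1, B]`, up to inversion. -/
theorem exists_reduction (h : OrderData k d M τ c) (hB0 : 0 < B)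
    (hB : B ^ 2 * M = (d + √(k : ℝ)) ^ 2) (hσ : σ = 1 ∨ σ = -1) {ε : ℝ}
    (hε : IsOrderElement k c σ ε) (hε1 : 1 ≤ ε) :
    ∃ (n : ℕ) (w : ℝ), IsOrderElement k c σ w ∧
      (Even n ∧ 1 ≤ w ∧ w < B ∧ ε = B ^ n * w ∨ Odd n ∧ 1 < w ∧ w ≤ B ∧ ε * w = B ^ (n + 1)) := by
  have hB1 := h.one_lt hB0 hB
  have hM : (0 : ℝ) < M := by exact_mod_cast h.M_pos
  have hu : IsOrderElement k c 1 (B ^ 2) := by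
    have := h.unit
    rwa [← hB, mul_div_cancel_right₀ _ hM.ne'] at this
  obtain ⟨n, h1, h2⟩ := exists_nat_pow_near hε1 hB1
  have hk := h.k_pos.le
  have hpow : ∀ m : ℕ, 0 < B ^ m := fun m ↦ pow_pos hB0 m
  -- Only even powers of B are known to lie in the order, so for odd n the quotient is Bⁿ⁺¹/ε rather
  -- than ε/Bⁿ.
  rcases Nat.even_or_odd n with hn | hn
  · refine ⟨n, (B ^ n)⁻¹ * ε, ?_, Or.inl ⟨hn, ?_, ?_, ?_⟩⟩
    · obtain ⟨m, rfl⟩ := hn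
      have := ((hu.pow hk h.mod_four m).inv hk (Or.inl rfl) (by positivity)).mul hk h.mod_four hε
      rwa [one_mul, ← pow_mul, two_mul] at this
    · rw [inv_mul_eq_div, le_div_iff₀ (hpow n)]
      linarith
    · rw [inv_mul_eq_div, div_lt_iff₀ (hpow n)]
      rw [pow_succ] at h2
      linarith
    · rw [mul_inv_cancel_left₀ (hpow n).ne']
  · refine ⟨n, B ^ (n + 1) * ε⁻¹, ?_, Or.inr ⟨hn, ?_, ?_, ?_⟩⟩
    · obtain ⟨m, rfl⟩ := hn
      have := (hu.pow hk h.mod_four (m + 1)).mul hk h.mod_four (hε.inv hk hσ (by positivity))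
      rwa [one_mul, ← pow_mul, show 2 * (m + 1) = 2 * m + 1 + 1 by ring] at this
    · rw [← div_eq_mul_inv, lt_div_iff₀ (by positivity)]
      linarith
    · rw [← div_eq_mul_inv, div_le_iff₀ (by positivity)]
      rw [pow_succ]
      nlinarith
    · field_simp

theorem norm_eq_one_of_one (h : OrderData k d M τ c) (hsq : ¬ IsSquare k)
    (hσ : σ = 1 ∨ σ = -1) (hw : IsOrderElement k c σ 1) : σ = 1 := by
  obtain ⟨X, Y, -, hY, hn, hwe⟩ := hw
  have hconj := IsOrderElement.conj_eq h.k_pos.le hn hwe one_ne_zero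
  rcases hσ with rfl | rfl
  · rfl
  · exfalso
    push_cast at hconj
    have : X = 0 := by
      have : (X : ℝ) = 0 := by linarith
      exact_mod_cast this
    subst this
    have hk := h.k_pos
    have hY : k * Y ^ 2 = 4 := by linarith
    have h1 : Y ^ 2 ≤ 4 := by nlinarith [sq_nonneg Y]
    have h2 : Y ≤ 2 := by nlinarith
    have h3 : -2 ≤ Y := by nlinarith
    interval_cases Y <;> try omega
    · exact hsq ⟨1, by omega⟩
    · exact hsq ⟨2, by omega⟩
    · exact hsq ⟨2, by omega⟩
    · exact hsq ⟨1, by omega⟩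

theorem isOrderElement_of_pell {p q : ℤ} (h : p ^ 2 - k * q ^ 2 = σ) :
    IsOrderElement k c σ (p + q * √(k : ℝ)) :=
  ⟨2 * p, 2 * q, ⟨p - q, by ring⟩, Or.inr (even_two_mul q), by linarith, by push_cast; ring⟩

theorem one_lt_of_pell (hk : 0 < k) {p q : ℤ} (hp : 0 < p) (hq : 0 < q) :
    1 < p + q * √(k : ℝ) := by
  have h1 : (1 : ℝ) ≤ p := by exact_mod_cast hp
  have h2 : (1 : ℝ) ≤ q := by exact_mod_cast hq
  have h3 : (0 : ℝ) < k := by exact_mod_cast hk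
  have : 0 < √(k : ℝ) := Real.sqrt_pos.2 h3
  nlinarith

theorem exists_conj (h : OrderData k d M τ c) (hsq : ¬ IsSquare k) (hσ : σ = 1 ∨ σ = -1)
    (hτσ : ¬ (τ = 1 ∧ σ = -1)) {p q : ℤ} (hp : 0 < p) (hq : 0 < q)
    (hpq : p ^ 2 - k * q ^ 2 = σ) : ∃ n : ℕ, 1 ≤ n ∧
      ((p : ℝ) + q * √(k : ℝ)) * (d - √(k : ℝ)) ^ n = (p - q * √(k : ℝ)) * (d + √(k : ℝ)) ^ n := by
  have hk : (0 : ℝ) < k := by exact_mod_cast h.k_pos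
  have hd : (0 : ℝ) < d := by exact_mod_cast h.d_pos
  have hM : (0 : ℝ) < M := by exact_mod_cast h.M_pos
  have hrr : √(k : ℝ) ^ 2 = k := Real.sq_sqrt hk.le
  have hr : 0 < √(k : ℝ) := Real.sqrt_pos.2 hk
  set B : ℝ := (d + √(k : ℝ)) / √(M : ℝ) with hBdef
  have hB0 : 0 < B := by positivity
  have hB : B ^ 2 * M = (d + √(k : ℝ)) ^ 2 := by
    rw [hBdef, div_pow, Real.sq_sqrt hM.le]
    field_simp
  have hε1 := one_lt_of_pell h.k_pos hp hq
  -- Even n leaves w = 1 and odd n leaves w = B; n = 0 is excluded by ε > 1.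
  have key : ∃ n : ℕ, 1 ≤ n ∧ (p + q * √(k : ℝ)) = B ^ n ∧ σ = τ ^ n := by
    obtain ⟨n, w, hw, ⟨hn, h1, h2, h3⟩ | ⟨hn, h1, h2, h3⟩⟩ :=
      h.exists_reduction hB0 hB hσ (isOrderElement_of_pell hpq) hε1.le
    · rcases h1.eq_or_lt with rfl | h1
      · refine ⟨n, ?_, by rw [h3, mul_one], ?_⟩
        · by_contra! hn0
          obtain rfl : n = 0 := by omega
          simp at h3
          linarith
        · rw [h.norm_eq_one_of_one hsq hσ hw]
          rcases h.sign with rfl | rfl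
          · simp
          · exact hn.neg_one_pow.symm
      · exact absurd (h.eq_of_le hB0 hB hσ hτσ hw h1 h2.le).1 h2.ne
    · obtain ⟨rfl, hστ⟩ := h.eq_of_le hB0 hB hσ hτσ hw h1 h2
      refine ⟨n, hn.pos, ?_, ?_⟩
      · rw [pow_succ] at h3
        exact mul_right_cancel₀ hB0.ne' h3
      · rw [hστ]
        rcases h.sign with rfl | rfl
        · simp
        · exact hn.neg_one_pow.symm
  obtain ⟨n, hn, h1, h2⟩ := key
  refine ⟨n, hn, ?_⟩
  have hs : (d : ℝ) ^ 2 - k = τ * M := by exact_mod_cast h.sq_sub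
  have hN : ((d : ℝ) - √(k : ℝ)) * (d + √(k : ℝ)) = τ * M := by linear_combination hs - hrr
  have hpqR : (p : ℝ) ^ 2 - k * q ^ 2 = σ := by exact_mod_cast hpq
  have hε : (p + q * √(k : ℝ)) * (p - q * √(k : ℝ)) = τ ^ n := by
    have : (σ : ℝ) = τ ^ n := by exact_mod_cast h2
    linear_combination hpqR + this - (q : ℝ) ^ 2 * hrr
  have hα : 0 < ((d : ℝ) + √(k : ℝ)) ^ n := by positivity
  have hε0 : 0 < (p + q * √(k : ℝ)) := by linarith
  apply mul_right_cancel₀ hα.ne'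
  apply mul_right_cancel₀ hε0.ne'
  calc (p + q * √(k : ℝ)) * (d - √(k : ℝ)) ^ n * (d + √(k : ℝ)) ^ n * (p + q * √(k : ℝ))
      = (p + q * √(k : ℝ)) ^ 2 * (((d : ℝ) - √(k : ℝ)) * (d + √(k : ℝ))) ^ n := by
        rw [mul_pow]; ring
    _ = τ ^ n * (B ^ 2 * M) ^ n := by
        rw [hN, h1, mul_pow, mul_pow, ← pow_mul, ← pow_mul, mul_comm n 2]; ring
    _ = (p + q * √(k : ℝ)) * (p - q * √(k : ℝ)) * ((d + √(k : ℝ)) ^ 2) ^ n := by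
        rw [hB, hε]
    _ = _ := by rw [← pow_mul, mul_comm 2 n, pow_mul]; ring

/-- If `d² > k` and the negative Pell equation is solvable, some element of norm `-1` of the order
is at most `B`. -/
theorem exists_small_of_neg_pell (h : OrderData k d M 1 c) (hsq : ¬ IsSquare k) {p q : ℤ}
    (hp : 0 < p) (hq : 0 < q) (hpq : p ^ 2 - k * q ^ 2 = -1) :
    ∃ X Y : ℤ, 0 < X ∧ 0 < Y ∧ Even (X - Y) ∧ (c ∨ Even Y) ∧ X ^ 2 + 4 = k * Y ^ 2 ∧
      M * X ^ 2 ≤ 4 * k := by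
  have hk : (0 : ℝ) < k := by exact_mod_cast h.k_pos
  have hd : (0 : ℝ) < d := by exact_mod_cast h.d_pos
  have hM : (0 : ℝ) < M := by exact_mod_cast h.M_pos
  have hr : 0 < √(k : ℝ) := Real.sqrt_pos.2 hk
  set B : ℝ := (d + √(k : ℝ)) / √(M : ℝ) with hBdef
  have hB0 : 0 < B := by positivity
  have hB : B ^ 2 * M = (d + √(k : ℝ)) ^ 2 := by
    rw [hBdef, div_pow, Real.sq_sqrt hM.le]
    field_simp
  have hε1 := one_lt_of_pell h.k_pos hp hq
  obtain ⟨w, hw, hw1, hwB⟩ : ∃ w, IsOrderElement k c (-1) w ∧ 1 < w ∧ w ≤ B := by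
    obtain ⟨n, w, hw, ⟨hn, h1, h2, h3⟩ | ⟨hn, h1, h2, h3⟩⟩ :=
      h.exists_reduction hB0 hB (Or.inr rfl) (isOrderElement_of_pell hpq) hε1.le
    · refine ⟨w, hw, lt_of_le_of_ne h1 ?_, h2.le⟩
      rintro rfl
      have := h.norm_eq_one_of_one hsq (Or.inr rfl) hw
      omega
    · exact ⟨w, hw, h1, h2⟩
  obtain ⟨X, Y, hXY, hY, hn, hwe⟩ := hw
  have hconj := IsOrderElement.conj_eq h.k_pos.le hn hwe (by linarith)
  push_cast at hconj
  have hi : w⁻¹ < 1 := inv_lt_one_of_one_lt₀ hw1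
  have hi0 : 0 < w⁻¹ := by positivity
  have hX : w - w⁻¹ = X := by linarith
  have hYr : w + w⁻¹ = Y * √(k : ℝ) := by linarith
  have hX0 : (0 : ℝ) < X := by linarith
  have hY0 : (0 : ℝ) < Y := pos_of_mul_pos_left (by linarith : 0 < Y * √(k : ℝ)) hr.le
  refine ⟨X, Y, by exact_mod_cast hX0, by exact_mod_cast hY0, hXY, hY, by linarith, ?_⟩
  have e := (h.inv_mul_sq hB0 hB).2
  push_cast at e
  rw [one_mul] at e
  have hBw : B⁻¹ ≤ w⁻¹ := inv_anti₀ (by linarith) hwB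
  have hle : (w - w⁻¹) ^ 2 ≤ (B - B⁻¹) ^ 2 := pow_le_pow_left₀ (by linarith) (by linarith) 2
  have := mul_le_mul_of_nonneg_right hle hM.le
  rw [e, hX] at this
  have : (M : ℝ) * X ^ 2 ≤ 4 * k := by linarith
  exact_mod_cast this

end OrderData

/-! ### Primitive pairs and their orders. -/

/-- Every pair is a multiple of a primitive one. -/
theorem exists_primitive_pair (k d : ℤ) (hd : 0 < d) : ∃ s k₁ d₁ : ℤ, 0 < s ∧ 0 < d₁ ∧
    k = s ^ 2 * k₁ ∧ d = s * d₁ ∧ ∀ t : ℤ, 0 < t → t ∣ d₁ → t ^ 2 ∣ k₁ → t = 1 := by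
  induction hn : d.toNat using Nat.strong_induction_on generalizing k d with
  | _ n ih =>
    by_cases h : ∀ t : ℤ, 0 < t → t ∣ d → t ^ 2 ∣ k → t = 1
    · exact ⟨1, k, d, one_pos, hd, by ring, by ring, h⟩
    · push Not at h
      obtain ⟨t, ht, ⟨e, rfl⟩, ⟨l, rfl⟩, ht1⟩ := h
      have he : 0 < e := pos_of_mul_pos_right hd ht.le
      have hlt : e < t * e := by nlinarith [show 2 ≤ t by omega]
      obtain ⟨s, k₁, d₁, hs, hd₁, rfl, rfl, h⟩ := ih e.toNat (by omega) l e he rfl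
      exact ⟨t * s, k₁, d₁, by positivity, hd₁, by ring, by ring, h⟩

/-- A primitive pair with `k - d² ∣ 4d²` has an associated order, either `ℤ[√k]` or
`ℤ[(1 + √k)/2]`. -/
theorem exists_orderData {k d : ℤ} (hk : 0 < k) (hsq : ¬ IsSquare k) (hd : 0 < d)
    (hdvd : k - d ^ 2 ∣ 4 * d ^ 2)
    (hprim : ∀ t : ℤ, 0 < t → t ∣ d → t ^ 2 ∣ k → t = 1) :
    ∃ M τ : ℤ, OrderData k d M τ False ∨
      OrderData k d M τ True ∧ Odd d ∧ 4 ∣ M := by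
  have hne : d ^ 2 - k ≠ 0 := fun h ↦ hsq ⟨d, by linarith⟩
  obtain ⟨M, τ, hM, hτ, hs⟩ : ∃ M τ : ℤ, 0 < M ∧ (τ = 1 ∨ τ = -1) ∧ d ^ 2 - k = τ * M := by
    rcases hne.lt_or_gt with h | h
    · exact ⟨k - d ^ 2, -1, by linarith, Or.inr rfl, by ring⟩
    · exact ⟨d ^ 2 - k, 1, by linarith, Or.inl rfl, by ring⟩
  have hττ : τ ^ 2 = 1 := by rcases hτ with rfl | rfl <;> norm_num
  have hMdvd : M ∣ 4 * d ^ 2 := by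
    obtain ⟨c, hc⟩ := hdvd
    exact ⟨-τ * c, by rw [hc]; linear_combination -c * hs⟩
  have hMk : M ∣ k - d ^ 2 := ⟨-τ, by linear_combination -hs⟩
  have hkR : (0 : ℝ) < k := by exact_mod_cast hk
  have hMR : (0 : ℝ) < M := by exact_mod_cast hM
  have hrr : √(k : ℝ) ^ 2 = k := Real.sq_sqrt hkR.le
  have hsR : (d : ℝ) ^ 2 - k = τ * M := by exact_mod_cast hs
  have hτR : (τ : ℝ) ^ 2 = 1 := by exact_mod_cast hττ
  refine ⟨M, τ, ?_⟩
  -- Write M = b²a with a squarefree. Then b ∣ 2d, so b or b/2 divides d and its square divides k;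
  -- primitivity leaves b = 1, giving ℤ[√k], or b = 2, giving d odd and k ≡ 1 mod 4.
  obtain ⟨a, b, hab, ha⟩ := Nat.sq_mul_squarefree M.toNat
  have hab' : (b : ℤ) ^ 2 * a = M := by
    have : ((b ^ 2 * a : ℕ) : ℤ) = M := by rw [hab]; omega
    exact_mod_cast this
  have ha' : Squarefree (a : ℤ) := Int.squarefree_natCast.2 ha
  have hb2 : (b : ℤ) ∣ 2 * d := by
    rw [← Int.pow_dvd_pow_iff two_ne_zero]
    refine (Dvd.intro _ hab').trans (hMdvd.trans (Dvd.intro 1 (by ring)))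
  have hb0 : 0 < (b : ℤ) := by
    rcases Nat.eq_zero_or_pos b with rfl | h
    · simp at hab'
      omega
    · exact_mod_cast h
  have hbk : ∀ t : ℤ, t ^ 2 ∣ M → t ∣ d → t ^ 2 ∣ k := fun t h1 h2 ↦ by
    have := dvd_add (h1.trans hMk) (pow_dvd_pow_of_dvd h2 2)
    simpa using this
  have hb12 : b = 1 ∨ b = 2 := by
    rcases Nat.even_or_odd' b with ⟨e, rfl | rfl⟩
    · right
      push_cast at *
      have h1 : (e : ℤ) ∣ d := Int.dvd_of_mul_dvd_mul_left two_ne_zero hb2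
      have := hprim e (by omega) h1 (hbk _ ⟨4 * a, by rw [← hab']; ring⟩ h1)
      omega
    · left
      have hcop : IsCoprime ((2 * e + 1 : ℕ) : ℤ) 2 := ⟨1, -e, by push_cast; ring⟩
      have h1 := hcop.dvd_of_dvd_mul_left hb2
      have := hprim _ hb0 h1 (hbk _ (Dvd.intro _ hab') h1)
      exact_mod_cast this
  rcases hb12 with rfl | rfl
  · left
    obtain rfl : (a : ℤ) = M := by simpa using hab'
    obtain ⟨t, ht⟩ : (a : ℤ) ∣ 2 * d :=
      (ha'.dvd_pow_iff_dvd two_ne_zero).1 (hMdvd.trans (Dvd.intro 1 (by ring)))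
    have htR : 2 * (d : ℝ) = a * t := by exact_mod_cast ht
    refine ⟨hk, hd, hM, hτ, hs, False.elim, False.elim, 2 * (d * t - τ), 2 * t,
      ⟨d * t - τ - t, by ring⟩, Or.inr (even_two_mul t), ?_, ?_⟩
    · linear_combination 4 * t ^ 2 * hs - 4 * t * τ * ht + 4 * hττ
    · rw [div_eq_div_iff hMR.ne' two_ne_zero]
      push_cast at hsR ⊢
      linear_combination 2 * hrr + (2 * d + 2 * √(k : ℝ)) * htR - 2 * hsR
  · right
    obtain rfl : (4 * a : ℤ) = M := by simpa using hab'
    have hda : (a : ℤ) ∣ d :=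
      (ha'.dvd_pow_iff_dvd two_ne_zero).1 (Int.dvd_of_mul_dvd_mul_left four_ne_zero hMdvd)
    obtain ⟨t, ht⟩ := hda
    have hodd : Odd d := by
      rw [← Int.not_even_iff_odd]
      intro he
      have := hprim 2 two_pos he.two_dvd (hbk 2 ⟨a, by ring⟩ he.two_dvd)
      omega
    have htR : (d : ℝ) = a * t := by exact_mod_cast ht
    refine ⟨⟨hk, hd, hM, hτ, hs, fun _ ↦ ?_, fun _ ↦ by omega, d * t - 2 * τ, t, ?_,
      Or.inl trivial, ?_, ?_⟩, hodd, ⟨a, rfl⟩⟩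
    · obtain ⟨e, rfl⟩ := hodd
      obtain rfl : k = 4 * (e ^ 2 + e - τ * a) + 1 := by linear_combination -hs
      omega
    · obtain ⟨e, he⟩ := hodd
      exact ⟨e * t - τ, by rw [he]; ring⟩
    · linear_combination t ^ 2 * hs - 4 * t * τ * ht + 4 * hττ
    · rw [div_eq_div_iff hMR.ne' two_ne_zero]
      push_cast at hsR ⊢
      linear_combination 2 * hrr + (4 * d + 4 * √(k : ℝ)) * htR - 2 * hsR

/-! ### Small solutions of norm -1. -/

/-- With X = 2x and Y = 2y, kMy² = Mx² + M ≤ 2k, so y = 1 and M ≤ 2. M = 1 would give d² = x² + 2,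
which is impossible. -/
theorem eq_of_neg_pell_integral {k d M X Y : ℤ} (hd : 0 < d) (hM : 0 < M)
    (hs : d ^ 2 - k = M) (hX : 0 < X) (hY : 0 < Y) (hX2 : Even X) (hY2 : Even Y)
    (hXY : X ^ 2 + 4 = k * Y ^ 2) (hle : M * X ^ 2 ≤ 4 * k) : k = 2 ∧ d = 2 := by
  obtain ⟨x, rfl⟩ := hX2
  obtain ⟨y, rfl⟩ := hY2
  have hx : 0 < x := by omega
  have hy : 0 < y := by omega
  have e1 : x ^ 2 + 1 = k * y ^ 2 := by linarith
  have e2 : M * x ^ 2 ≤ k := by linarith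
  have hx2 : 1 ≤ x ^ 2 := by nlinarith
  have hk : 0 < k := by nlinarith
  have hMk : M ≤ k := by nlinarith
  have e3 : k * (M * y ^ 2) ≤ k * 2 := by nlinarith
  have e4 : M * y ^ 2 ≤ 2 := le_of_mul_le_mul_left e3 hk
  have hy1 : y = 1 := by nlinarith
  subst hy1
  have hM2 : M ≤ 2 := by linarith
  interval_cases M
  · exfalso
    have h1 : x < d := by nlinarith
    have : x + 1 ≤ d := h1
    nlinarith
  · have : k = 2 := by nlinarith
    subst this
    exact ⟨rfl, by nlinarith⟩

/-- With M = 4a, kaY² = aX² + 4a ≤ 5k, so aY² ≤ 5. For Y = 1 and X ≥ 4 one gets a = 1 and d² = X² +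
8, impossible; the rest is a finite check. -/
theorem eq_of_neg_pell_half_integral {k d M X Y : ℤ} (hd : 0 < d) (hdo : Odd d) (hM : 0 < M)
    (hM4 : 4 ∣ M) (hs : d ^ 2 - k = M) (hX : 0 < X) (hY : 0 < Y)
    (hXY : X ^ 2 + 4 = k * Y ^ 2) (hle : M * X ^ 2 ≤ 4 * k) : k = 5 ∧ (d = 3 ∨ d = 5) := by
  obtain ⟨a, rfl⟩ := hM4
  have ha : 0 < a := by omega
  have e2 : a * X ^ 2 ≤ k := by linarith
  have hx2 : 1 ≤ X ^ 2 := by nlinarith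
  have hk : 0 < k := by nlinarith
  have hMk : a ≤ k := by nlinarith
  have e3 : k * (a * Y ^ 2) ≤ k * 5 := by nlinarith
  have e4 : a * Y ^ 2 ≤ 5 := le_of_mul_le_mul_left e3 hk
  have ha5 : a ≤ 5 := by nlinarith
  have hY2 : Y ≤ 2 := by nlinarith
  have hdodd : d % 2 = 1 := Int.odd_iff.1 hdo
  interval_cases Y
  · have hk4 : k = X ^ 2 + 4 := by linarith
    subst hk4
    have hX3 : X ≤ 3 := by
      by_contra! hX4
      obtain rfl : a = 1 := by nlinarith
      nlinarith [show X + 1 ≤ d by nlinarith]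
    have hd5 : d < 6 := by nlinarith
    interval_cases d <;> try omega
    all_goals interval_cases X <;> omega
  · obtain rfl : a = 1 := by omega
    omega

/-! ### The dichotomy and the exceptional pairs. -/

/-- The dichotomy for a pair with `k - d² ∣ 4d²`: a solution of `p² - kq² = ±1` lies on the orbit
unless `d² > k` and the norm is `-1`, and in this case `(k, d)` is of a special form. -/
theorem conj_or_special {k d : ℤ} (hk : 0 < k) (hsq : ¬ IsSquare k) (hd : 0 < d)
    (hdvd : k - d ^ 2 ∣ 4 * d ^ 2) {p q σ : ℤ} (hσ : σ = 1 ∨ σ = -1) (hp : 0 < p) (hq : 0 < q)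
    (hpq : p ^ 2 - k * q ^ 2 = σ) :
    (∃ n : ℕ, 1 ≤ n ∧ ((p : ℝ) + q * √(k : ℝ)) * (d - √(k : ℝ)) ^ n =
      (p - q * √(k : ℝ)) * (d + √(k : ℝ)) ^ n) ∨
    σ = -1 ∧ ∃ s : ℤ, 0 < s ∧
      (k = 5 * s ^ 2 ∧ (d = 3 * s ∨ d = 5 * s) ∨ k = 2 * s ^ 2 ∧ d = 2 * s) := by
  obtain ⟨s, k₁, d₁, hs, hd₁, rfl, rfl, hprim⟩ := exists_primitive_pair k d hd
  have hk₁ : 0 < k₁ := pos_of_mul_pos_right hk (by positivity)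
  have hsq₁ : ¬ IsSquare k₁ := fun ⟨x, hx⟩ ↦ hsq ⟨s * x, by rw [hx]; ring⟩
  have hdvd₁ : k₁ - d₁ ^ 2 ∣ 4 * d₁ ^ 2 := by
    apply Int.dvd_of_mul_dvd_mul_left (pow_ne_zero 2 hs.ne')
    convert hdvd using 1 <;> ring
  have hsR : (0 : ℝ) < s := by exact_mod_cast hs
  have hroot : √((s ^ 2 * k₁ : ℤ) : ℝ) = s * √(k₁ : ℝ) := by
    push_cast
    rw [Real.sqrt_mul (by positivity), Real.sqrt_sq hsR.le]
  have hsq' : 0 < s * q := by positivity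
  -- (p, sq) solves the equation for k₁ with the same value of p + q√k, and the orbit identity is
  -- homogeneous of degree n in (d, √k).
  have hpq₁ : p ^ 2 - k₁ * (s * q) ^ 2 = σ := by rw [← hpq]; ring
  have orbit : ∀ {M τ : ℤ} {c : Prop}, OrderData k₁ d₁ M τ c → ¬ (τ = 1 ∧ σ = -1) →
      ∃ n : ℕ, 1 ≤ n ∧ ((p : ℝ) + q * √((s ^ 2 * k₁ : ℤ) : ℝ)) *
        ((s * d₁ : ℤ) - √((s ^ 2 * k₁ : ℤ) : ℝ)) ^ n =
        (p - q * √((s ^ 2 * k₁ : ℤ) : ℝ)) * ((s * d₁ : ℤ) + √((s ^ 2 * k₁ : ℤ) : ℝ)) ^ n := by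
    intro M τ c h hτσ
    obtain ⟨n, hn, e⟩ := h.exists_conj hsq₁ hσ hτσ hp hsq' hpq₁
    refine ⟨n, hn, ?_⟩
    rw [hroot]
    push_cast at e ⊢
    rw [← mul_sub, ← mul_add, mul_pow, mul_pow]
    linear_combination (s : ℝ) ^ n * e
  obtain ⟨M, τ, h⟩ := exists_orderData hk₁ hsq₁ hd₁ hdvd₁ hprim
  by_cases hτσ : τ = 1 ∧ σ = -1
  · obtain ⟨rfl, rfl⟩ := hτσ
    right
    refine ⟨rfl, s, hs, ?_⟩
    rcases h with h | ⟨h, hodd, h4⟩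
    · obtain ⟨X, Y, hX, hY, hXY, hY2, e, hle⟩ := h.exists_small_of_neg_pell hsq₁ hp hsq' hpq₁
      have hYe : Even Y := by simpa using hY2
      have hXe : Even X := by simpa using hXY.add hYe
      obtain ⟨rfl, rfl⟩ := eq_of_neg_pell_integral hd₁ h.M_pos (by linarith [h.sq_sub]) hX hY
        hXe hYe e hle
      exact Or.inr ⟨by ring, by ring⟩
    · obtain ⟨X, Y, hX, hY, -, -, e, hle⟩ := h.exists_small_of_neg_pell hsq₁ hp hsq' hpq₁
      obtain ⟨rfl, rfl | rfl⟩ := eq_of_neg_pell_half_integral hd₁ hodd h.M_pos h4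
        (by linarith [h.sq_sub]) hX hY e hle
      · exact Or.inl ⟨by ring, Or.inl (by ring)⟩
      · exact Or.inl ⟨by ring, Or.inr (by ring)⟩
  · left
    rcases h with h | ⟨h, -, -⟩
    · exact orbit h hτσ
    · exact orbit h hτσ

theorem isExceptionalPair_of_neg_pell {k d s p q : ℤ} (hs : 0 < s) (hp : 0 < p) (hq : 0 < q)
    (hpq : p ^ 2 - k * q ^ 2 = -1)
    (h : k = 5 * s ^ 2 ∧ (d = 3 * s ∨ d = 5 * s) ∨ k = 2 * s ^ 2 ∧ d = 2 * s) :
    IsExceptionalPair k d := by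
  lift s to ℕ using hs.le
  lift p to ℕ using hp.le
  lift q to ℕ using hq.le
  refine ⟨s, by exact_mod_cast hs, ?_⟩
  rcases h with ⟨rfl, h⟩ | ⟨rfl, h⟩
  -- p² - 5s²q² = -1, multiplied by 4, reads (2p)² + 4 = 5(2sq)²; hence the factor 2 in 2s ∣ F₂ₙ₊₁.
  · obtain ⟨n, hn, -⟩ := exists_fib_of_neg_pell_five (2 * s * q) (2 * p) (by
      zify
      linarith)
    exact Or.inl ⟨rfl, h, n, ⟨q, hn.symm⟩⟩
  · obtain ⟨n, hn, -⟩ := exists_pellNumber_of_neg_pell_two (s * q) p (by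
      zify
      linarith)
    exact Or.inr ⟨rfl, h, n, ⟨q, hn.symm⟩⟩

/-- For an exceptional pair `d² > k` and the negative Pell equation is solvable. -/
theorem IsExceptionalPair.exists_neg_pell {k d : ℤ} (h : IsExceptionalPair k d) :
    2 ≤ k ∧ k < d ^ 2 ∧ ∃ p q : ℤ, 0 < p ∧ 0 < q ∧ p ^ 2 - k * q ^ 2 = -1 := by
  obtain ⟨s, hs, ⟨rfl, hd, n, q, hq⟩ | ⟨rfl, rfl, n, q, hq⟩⟩ := h
  · have hs' : (1 : ℤ) ≤ s := by exact_mod_cast hs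
    refine ⟨by nlinarith, by rcases hd with rfl | rfl <;> nlinarith, ?_⟩
    obtain ⟨x, hx, e, -⟩ := exists_sq_add_four_eq_fib n
    have hF : 0 < Nat.fib (2 * n + 1) := Nat.fib_pos.2 (by omega)
    rw [hq] at e hF
    have hq0 : 0 < q := Nat.pos_of_mul_pos_left hF
    obtain ⟨p, rfl⟩ : 2 ∣ x := by
      have : 2 ∣ x ^ 2 := (Nat.dvd_add_left (by norm_num : 2 ∣ 4)).1
        (e ▸ ⟨10 * (s * q) ^ 2, by ring⟩)
      exact Nat.prime_two.dvd_of_dvd_pow this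
    refine ⟨p, q, by omega, by exact_mod_cast hq0, ?_⟩
    zify at e
    linarith
  · have hs' : (1 : ℤ) ≤ s := by exact_mod_cast hs
    refine ⟨by nlinarith, by nlinarith, ?_⟩
    obtain ⟨x, hx, e, -⟩ := exists_sq_add_one_eq_pellNumber n
    rw [hq] at e
    have hq0 : 0 < q := by
      rcases Nat.eq_zero_or_pos q with rfl | h
      · simp at e
      · exact h
    refine ⟨x, q, by exact_mod_cast hx, by exact_mod_cast hq0, ?_⟩
    zify at e
    linarith

theorem div_lt_sqrt_of_neg_pell {k p q : ℤ} (hp : 0 < p) (hq : 0 < q)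
    (h : p ^ 2 - k * q ^ 2 = -1) : (p : ℝ) / q < √(k : ℝ) := by
  have hqR : (0 : ℝ) < q := by exact_mod_cast hq
  have hpR : (0 : ℝ) < p := by exact_mod_cast hp
  have hR : (p : ℝ) ^ 2 - k * q ^ 2 = -1 := by exact_mod_cast h
  apply Real.lt_sqrt_of_sq_lt
  rw [div_pow, div_lt_iff₀ (by positivity)]
  linarith

theorem corollary6p6 (k d : ℤ) (hk : 0 < k) (hsq : ¬ IsSquare k) (hd : 0 < d)
    (hR : ∃ R : ℤ, (4 * (d : ℚ) ^ 2) / ((k : ℚ) - (d : ℚ) ^ 2) = (R : ℚ)) :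
    ((∀ p q : ℤ, IsPellianConvergent k p q →
        (((p : ℝ) / (q : ℝ) : ℝ) : OnePoint ℝ) ∈ orbitInfty (k : ℝ) (d : ℝ)) ↔
      ¬ IsExceptionalPair k d) ∧
    (∀ p q : ℤ, IsSqrtConvergent k p q → p ^ 2 - k * q ^ 2 = 1 →
        (((p : ℝ) / (q : ℝ) : ℝ) : OnePoint ℝ) ∈ orbitInfty (k : ℝ) (d : ℝ)) := by
  have hdvd : k - d ^ 2 ∣ 4 * d ^ 2 := by
    obtain ⟨R, hR⟩ := hR
    have hne : (k : ℚ) - (d : ℚ) ^ 2 ≠ 0 := fun h0 ↦ hsq ⟨d, by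
      have : (k : ℚ) = d * d := by linarith
      exact_mod_cast this⟩
    rw [div_eq_iff hne] at hR
    exact ⟨R, by rw [mul_comm _ R]; exact_mod_cast hR⟩
  have hkR : (0 : ℝ) < k := by exact_mod_cast hk
  have hdR : (0 : ℝ) < d := by exact_mod_cast hd
  have hcast : ∀ q : ℤ, 0 < q → (q : ℝ) ≠ 0 := fun q hq ↦ by exact_mod_cast hq.ne'
  refine ⟨⟨fun hall hexc ↦ ?_, fun hexc p q ⟨⟨hp, hq, _, _⟩, hpq⟩ ↦ ?_⟩,
    fun p q ⟨hp, hq, _, _⟩ hpq ↦ ?_⟩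
  · obtain ⟨hk2, hkd, p, q, hp, hq, hpq⟩ := hexc.exists_neg_pell
    have hmem := hall p q ⟨isSqrtConvergent_of_neg_pell hk2 hp hq hpq, Or.inr hpq⟩
    exact (sqrt_lt_of_mem_orbitInfty hkR hdR (by exact_mod_cast hkd) hmem).not_gt
      (div_lt_sqrt_of_neg_pell hp hq hpq)
  · rcases conj_or_special hk hsq hd hdvd hpq hp hq rfl with ⟨n, hn, e⟩ | ⟨hσ, s, hs, h⟩
    · exact mem_orbitInfty_of_conj hkR hdR (hcast q hq) hn e
    · exact absurd (isExceptionalPair_of_neg_pell hs hp hq hσ h) hexc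
  · rcases conj_or_special hk hsq hd hdvd (Or.inl rfl) hp hq hpq with ⟨n, hn, e⟩ | ⟨hσ, -⟩
    · exact mem_orbitInfty_of_conj hkR hdR (hcast q hq) hn e
    · omega
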